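/- Consider the cake $[0,1]$ and three players; player $i$ has a valuation $V_i(S)=\int_S v_i(x)\,dx$ given by a non-negative integrable density $v_i$ on $[0,1]$ with $V_i([0,1])=1$. A deterministic Robertson--Webb protocol adaptively asks queries of two types: $\mathrm{Cut}_i(\alpha)$ with $\alpha\in[0,1]$, to which player $i$ answers with a point $y\in[0,1]$ such that $V_i([0,y])=\alpha$ (ties are resolved by a fixed deterministic rule), and $y$ becomes a cut point; and $\mathrm{Eval}_i(y)$, where $y$ is a previously made cut point (or $0$ or $1$), to which player $i$ answers $V_i([0,y])$. When it stops, it outputs an allocation $(A_1,A_2,A_3)$ of $[0,1]$ into pairwise disjoint pieces demarcated by cut points made during the execution (and the endpoints $0,1$). The allocation is connected if each $A_i$ is an interval, and $\epsilon$-envy-free if $V_i(A_i)\ge V_i(A_j)-\epsilon$ for all $i,j$. Theorem. Computing a connected $\epsilon$-envy-free allocation for three players requires $\Omega(\log\frac1\epsilon)$ queries. That is, there are absolute constants $c>0$ and $\epsilon_0>0$ such that, for every tie-breaking rule, every $0<\epsilon<\epsilon_0$ and every deterministic Robertson--Webb protocol which, for all valuations $V_1,V_2,V_3$ of the three players, stops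 and outputs a connected $\epsilon$-envy-free allocation, there are valuations $V_1,V_2,V_3$ on which the protocol asks at least $c\log\frac1\epsilon$ queries. -/

import Mathlib

namespace CakeCutting

/-- A valuation of the cake `[0,1]`: a non-negative integrable value density, normalized so that
the whole cake is worth `1`. Values of the density outside `[0,1]` are never used. -/
structure Valuation where
  density : ℝ → ℝ
  nonneg : ∀ x ∈ Set.Icc (0 : ℝ) 1, 0 ≤ density x
  integrable : MeasureTheory.IntegrableOn density (Set.Icc 0 1)
  total : ∫ x in Set.Icc (0 : ℝ) 1, density x = 1

/-- The value of a piece of cake (a subset of `[0,1]`). -/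
noncomputable def Valuation.value (v : Valuation) (S : Set ℝ) : ℝ :=
  ∫ x in S, v.density x

/-- An allocation with connected pieces: `A i` is the piece of player `i`, the pieces are pairwise
disjoint intervals and their union is `[0,1]`. (A degenerate interval is allowed.) -/
def IsConnectedAllocation {n : ℕ} (A : Fin n → Set ℝ) : Prop :=
  (∀ i, (A i).OrdConnected) ∧ (∀ i j, i ≠ j → Disjoint (A i) (A j)) ∧ ⋃ i, A i = Set.Icc 0 1

/-- No player values the piece of another player by more than `ε` above their own piece. -/
def IsEnvyFree {n : ℕ} (ε : ℝ) (V : Fin n → Valuation) (A : Fin n → Set ℝ) : Prop :=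
  ∀ i j, (V i).value (A j) - ε ≤ (V i).value (A i)

/-- The allocation is demarcated by points of `S`. The frontier in `ℝ` of an interval contained
in `[0,1]` consists of its endpoints. -/
def DemarcatedBy {n : ℕ} (S : Set ℝ) (A : Fin n → Set ℝ) : Prop :=
  ∀ i, frontier (A i) ⊆ S

/-- A deterministic rule by which players answer cut queries: for every `α ∈ [0,1]`, a player with
valuation `v` marks a point `y ∈ [0,1]` such that `[0,y]` is worth exactly `α`; the rule says which
point is taken if there are several. -/
structure CutRule where
  point : Valuation → Set.Icc (0 : ℝ) 1 → ℝ
  mem : ∀ (v : Valuation) (α : Set.Icc (0 : ℝ) 1), point v α ∈ Set.Icc (0 : ℝ) 1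
  value_eq : ∀ (v : Valuation) (α : Set.Icc (0 : ℝ) 1),
    v.value (Set.Icc 0 (point v α)) = (α : ℝ)

/-- What a protocol does next: ask player `i` the query `Cut_i(α)`, ask player `i` the query
`Eval_i(y)`, or stop and output an allocation. -/
inductive Action (n : ℕ) where
  | cut (i : Fin n) (α : Set.Icc (0 : ℝ) 1)
  | eval (i : Fin n) (y : ℝ)
  | output (A : Fin n → Set ℝ)

/-- A deterministic adaptive protocol: the next action as a function of the list of the answers
received so far, in chronological order. (As the protocol is deterministic, the answers determine
the queries asked.) -/
def Protocol (n : ℕ) := List ℝ → Action n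

/-- `Reaches R P V h S`: when `P` is run on players with valuations `V`, there is a moment at which
the answers received so far are `h` and the points available are those of `S`, namely the cut
points made so far and the endpoints `0` and `1` of the cake. Every query adds one entry to `h`.
An evaluation query may only be asked at an available point. -/
inductive Reaches {n : ℕ} (R : CutRule) (P : Protocol n) (V : Fin n → Valuation) :
    List ℝ → Set ℝ → Prop
  | start : Reaches R P V [] {0, 1}
  | cut {h : List ℝ} {S : Set ℝ} {i : Fin n} {α : Set.Icc (0 : ℝ) 1} :
      Reaches R P V h S → P h = Action.cut i α →
      Reaches R P V (h ++ [R.point (V i) α]) (insert (R.point (V i) α) S)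
  | eval {h : List ℝ} {S : Set ℝ} {i : Fin n} {y : ℝ} :
      Reaches R P V h S → P h = Action.eval i y → y ∈ S →
      Reaches R P V (h ++ [(V i).value (Set.Icc 0 y)]) S

/-- Run on players with valuations `V`, the protocol `P` stops after exactly `q` queries (cut and
evaluation queries together) and outputs the allocation `A`, which has to be demarcated by
available points. -/
def Outputs {n : ℕ} (R : CutRule) (P : Protocol n) (V : Fin n → Valuation) (q : ℕ)
    (A : Fin n → Set ℝ) : Prop :=
  ∃ (h : List ℝ) (S : Set ℝ), Reaches R P V h S ∧ h.length = q ∧ P h = Action.output A ∧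
    DemarcatedBy S A

/-- On every instance, `P` is a Robertson-Webb protocol that stops and outputs a connected
`ε`-envy-free allocation. -/
def FindsConnectedEnvyFree {n : ℕ} (R : CutRule) (ε : ℝ) (P : Protocol n) : Prop :=
  ∀ V : Fin n → Valuation, ∃ (q : ℕ) (A : Fin n → Set ℝ),
    Outputs R P V q A ∧ IsConnectedAllocation A ∧ IsEnvyFree ε V A

end CakeCutting

namespace CakeCutting

open MeasureTheory Set

/-! An adversary keeps the players undecided about the cuts `1/3` and `2/3`. Player `i` values the
pieces `i` and `i+1` (cyclically) equally, at about `7/20`, and the third at about `3/10`. If both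
cuts move away by at least `w`, the ties break so that nobody wants some piece or two players insist
on the same one, with a margin above `ε` as long as `100 * ε ≤ w` (`exists_envy`). So the protocol
cannot stop while every available point is at distance at least `w` from `1/3` and `2/3`.

The densities equal `1` within `w` of these points, so nothing is committed there. Before a cut
answer, mass is moved across `1/3` and `2/3` inside the windows, along a direction that keeps the
tie. This leaves the values of initial segments outside the windows, hence all earlier answers,
unchanged, and a suitable shift pushes the new cut point to distance `w / 17`
(`Undecided.exists_answer`). Evaluations cost nothing. Each query shrinks the scale by at most `17`,
so logarithmically many are needed. -/

/-! ### Values of initial segments -/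

/-- The value of the initial segment `[0,z]`. -/
noncomputable def Valuation.cdf (v : Valuation) (z : ℝ) : ℝ :=
  v.value (Icc 0 z)

theorem Valuation.integrableOn (v : Valuation) {S : Set ℝ} (hS : S ⊆ Icc 0 1) :
    IntegrableOn v.density S :=
  v.integrable.mono_set hS

theorem Valuation.cdf_one (v : Valuation) : v.cdf 1 = 1 := v.total

theorem Valuation.cdf_zero (v : Valuation) : v.cdf 0 = 0 := by
  simp [Valuation.cdf, Valuation.value]

theorem Valuation.cdf_eq_add (v : Valuation) {a b : ℝ} (ha : 0 ≤ a) (hab : a ≤ b) (hb : b ≤ 1) :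
    v.cdf b = v.cdf a + ∫ x in Ioc a b, v.density x := by
  unfold Valuation.cdf Valuation.value
  rw [← Icc_union_Ioc_eq_Icc ha hab, setIntegral_union _ measurableSet_Ioc]
  · exact v.integrableOn (Icc_subset_Icc_right (hab.trans hb))
  · exact v.integrableOn fun x hx => ⟨ha.trans hx.1.le, hx.2.trans hb⟩
  · exact Set.disjoint_left.2 fun x hx hx' => absurd hx.2 (not_le.2 hx'.1)

theorem Valuation.le_cdf_sub (v : Valuation) {m a b : ℝ}
    (hm : ∀ x ∈ Icc (0 : ℝ) 1, m ≤ v.density x) (ha : 0 ≤ a) (hab : a ≤ b) (hb : b ≤ 1) :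
    m * (b - a) ≤ v.cdf b - v.cdf a := by
  have hs : Ioc a b ⊆ Icc 0 1 := fun x hx => ⟨ha.trans hx.1.le, hx.2.trans hb⟩
  have h := setIntegral_mono_on (μ := volume) (integrableOn_const (C := m) (by simp))
    (v.integrableOn hs) measurableSet_Ioc fun x hx => hm x (hs hx)
  rw [setIntegral_const, Real.volume_real_Ioc_of_le hab, smul_eq_mul] at h
  rw [v.cdf_eq_add ha hab hb]
  linarith

theorem Valuation.cdf_sub_le (v : Valuation) {M a b : ℝ}
    (hM : ∀ x ∈ Icc (0 : ℝ) 1, v.density x ≤ M) (ha : 0 ≤ a) (hab : a ≤ b) (hb : b ≤ 1) :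
    v.cdf b - v.cdf a ≤ M * (b - a) := by
  have hs : Ioc a b ⊆ Icc 0 1 := fun x hx => ⟨ha.trans hx.1.le, hx.2.trans hb⟩
  have h := setIntegral_mono_on (μ := volume) (v.integrableOn hs)
    (integrableOn_const (C := M) (by simp)) measurableSet_Ioc fun x hx => hM x (hs hx)
  rw [setIntegral_const, Real.volume_real_Ioc_of_le hab, smul_eq_mul] at h
  rw [v.cdf_eq_add ha hab hb]
  linarith

theorem Valuation.cdf_strictMonoOn (v : Valuation) {m : ℝ} (hm0 : 0 < m)
    (hm : ∀ x ∈ Icc (0 : ℝ) 1, m ≤ v.density x) : StrictMonoOn v.cdf (Icc 0 1) := by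
  intro a ha b hb hab
  have := v.le_cdf_sub hm ha.1 hab.le hb.2
  have := mul_pos hm0 (sub_pos.2 hab)
  linarith

theorem Valuation.cdf_sub_of_density_eq_one (v : Valuation) {a b : ℝ}
    (ha : 0 ≤ a) (hab : a ≤ b) (hb : b ≤ 1) (h : ∀ x ∈ Icc a b, v.density x = 1) :
    v.cdf b - v.cdf a = b - a := by
  rw [v.cdf_eq_add ha hab hb, setIntegral_congr_fun measurableSet_Ioc
    fun x hx => h x (Ioc_subset_Icc_self hx)]
  simp [hab]

/-- Near a point around which the density is `1`, the value of `[0,z]` grows like `z`. -/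
theorem Valuation.cdf_sub_eq_sub (v : Valuation) {c w z : ℝ} (hc : 0 ≤ c - w) (hc' : c + w ≤ 1)
    (h : ∀ x, |x - c| < w → v.density x = 1) (hz : |z - c| < w) :
    v.cdf z - v.cdf c = z - c := by
  have hz' := abs_lt.1 hz
  rcases le_total c z with hcz | hcz
  · exact v.cdf_sub_of_density_eq_one (by linarith) hcz (by linarith) fun x hx =>
      h x (abs_lt.2 ⟨by linarith [hx.1, hx.2], by linarith [hx.1, hx.2]⟩)
  · have := v.cdf_sub_of_density_eq_one (a := z) (b := c) (by linarith) hcz (by linarith) fun x hx =>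
      h x (abs_lt.2 ⟨by linarith [hx.1, hx.2], by linarith [hx.1, hx.2]⟩)
    linarith

/-! ### Local perturbations of a density -/

/-- A density of total mass `0` that moves mass `u` from the right part `(c+w', c+w]` of an
interval around `c` to its left part `[c-w, c-w')`. -/
noncomputable def bump (c w w' u : ℝ) (x : ℝ) : ℝ :=
  (Ico (c - w) (c - w')).indicator (fun _ => u / (w - w')) x -
    (Ioc (c + w') (c + w)).indicator (fun _ => u / (w - w')) x

theorem integrable_indicator_Ico {a b k : ℝ} :
    Integrable ((Ico a b).indicator fun _ => k : ℝ → ℝ) :=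
  (integrable_indicator_iff measurableSet_Ico).2 (integrableOn_const (by simp))

theorem integrable_indicator_Ioc {a b k : ℝ} :
    Integrable ((Ioc a b).indicator fun _ => k : ℝ → ℝ) :=
  (integrable_indicator_iff measurableSet_Ioc).2 (integrableOn_const (by simp))

theorem integrable_bump (c w w' u : ℝ) : Integrable (bump c w w' u) :=
  integrable_indicator_Ico.sub integrable_indicator_Ioc

theorem abs_bump_le {c w w' u κ : ℝ} (hw' : 0 < w') (hw : w' < w) (hu : |u| ≤ κ * (w - w'))
    (x : ℝ) : |bump c w w' u x| ≤ κ := by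
  have h : |u / (w - w')| ≤ κ := by
    rw [abs_div, abs_of_pos (sub_pos.2 hw)]
    exact (div_le_iff₀ (sub_pos.2 hw)).2 hu
  have hκ : 0 ≤ κ := (abs_nonneg _).trans h
  unfold bump
  by_cases h1 : x ∈ Ico (c - w) (c - w')
  · have h2 : x ∉ Ioc (c + w') (c + w) := fun h2 => by linarith [h1.2, h2.1]
    rw [indicator_of_mem h1, indicator_of_notMem h2, sub_zero]
    exact h
  · by_cases h2 : x ∈ Ioc (c + w') (c + w)
    · rw [indicator_of_notMem h1, indicator_of_mem h2, zero_sub, abs_neg]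
      exact h
    · rw [indicator_of_notMem h1, indicator_of_notMem h2]
      simpa using hκ

theorem bump_eq_zero {c w w' u x : ℝ} (hw' : 0 < w') (hw : w' < w)
    (h : |x - c| ≤ w' ∨ w < |x - c|) : bump c w w' u x = 0 := by
  have h1 : x ∉ Ico (c - w) (c - w') := by
    rintro ⟨h1, h2⟩
    rcases h with h | h
    · linarith [(abs_le.1 h).1]
    · rcases lt_abs.1 h with h | h <;> linarith
  have h2 : x ∉ Ioc (c + w') (c + w) := by
    rintro ⟨h1, h2⟩
    rcases h with h | h
    · linarith [(abs_le.1 h).2]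
    · rcases lt_abs.1 h with h | h <;> linarith
  simp [bump, h1, h2]

theorem setIntegral_indicator_Ioc {a b z k : ℝ} (ha : 0 ≤ a) :
    ∫ x in Icc 0 z, (Ioc a b).indicator (fun _ => k) x = max 0 (min z b - a) * k := by
  rw [setIntegral_indicator measurableSet_Ioc, setIntegral_const, smul_eq_mul]
  congr 1
  have : Icc 0 z ∩ Ioc a b = Ioc a (min z b) := by
    ext x
    simp only [mem_inter_iff, mem_Icc, mem_Ioc, le_min_iff]
    constructor
    · rintro ⟨⟨_, h2⟩, h3, h4⟩
      exact ⟨h3, h2, h4⟩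
    · rintro ⟨h3, h2, h4⟩
      exact ⟨⟨by linarith, h2⟩, h3, h4⟩
  rw [this, Measure.real, Real.volume_Ioc, ENNReal.toReal_ofReal', max_comm]

theorem setIntegral_indicator_Ico {a b z k : ℝ} (ha : 0 ≤ a) :
    ∫ x in Icc 0 z, (Ico a b).indicator (fun _ => k) x = max 0 (min z b - a) * k := by
  rw [← setIntegral_indicator_Ioc ha]
  exact integral_congr_ae (ae_restrict_of_ae (indicator_ae_eq_of_ae_eq_set Ico_ae_eq_Ioc))

theorem setIntegral_bump {c w w' u z : ℝ} (hc : 0 ≤ c - w) (hw' : 0 < w') (hw : w' < w) :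
    ∫ x in Icc 0 z, bump c w w' u x =
      (max 0 (min z (c - w') - (c - w)) - max 0 (min z (c + w) - (c + w'))) *
        (u / (w - w')) := by
  unfold bump
  rw [integral_sub integrable_indicator_Ico.integrableOn integrable_indicator_Ioc.integrableOn,
    setIntegral_indicator_Ico hc, setIntegral_indicator_Ioc (by linarith), sub_mul]

theorem setIntegral_bump_center {c w w' u : ℝ} (hc : 0 ≤ c - w) (hw' : 0 < w') (hw : w' < w) :
    ∫ x in Icc 0 c, bump c w w' u x = u := by
  rw [setIntegral_bump hc hw' hw, min_eq_right (by linarith), min_eq_left (by linarith),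
    max_eq_right (by linarith), max_eq_left (by linarith)]
  have : w - w' ≠ 0 := (sub_pos.2 hw).ne'
  field_simp
  ring

theorem setIntegral_bump_of_le_abs {c w w' u z : ℝ} (hc : 0 ≤ c - w) (hw' : 0 < w') (hw : w' < w)
    (hz : w ≤ |z - c|) : ∫ x in Icc 0 z, bump c w w' u x = 0 := by
  rw [setIntegral_bump hc hw' hw]
  rcases le_abs.1 hz with h | h
  · rw [min_eq_right (by linarith), min_eq_right (by linarith),
      max_eq_right (by linarith), max_eq_right (by linarith)]
    ring
  · rw [min_eq_left (by linarith), min_eq_left (by linarith),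
      max_eq_left (by linarith), max_eq_left (by linarith)]
    ring

/-- The value of `[0,1/3]` and of `[0,2/3]` can be changed independently, keeping the value of
`[0,z]` for all `z` that are not close to `1/3` or `2/3`. -/
theorem Valuation.exists_perturb (v : Valuation) {w w' κ a b : ℝ} (hw' : 0 < w') (hw : w' < w)
    (hw6 : w < 1 / 6) (hκ : κ < 1) (ha : |a| ≤ κ * (w - w')) (hb : |b| ≤ κ * (w - w'))
    (hv : ∀ x ∈ Icc (0 : ℝ) 1, |v.density x - 1| ≤ κ)
    (hv' : ∀ x, |x - 1 / 3| ≤ w ∨ |x - 2 / 3| ≤ w → v.density x = 1) :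
    ∃ v' : Valuation, (∀ x ∈ Icc (0 : ℝ) 1, |v'.density x - 1| ≤ κ) ∧
      (∀ x, |x - 1 / 3| ≤ w' ∨ |x - 2 / 3| ≤ w' → v'.density x = 1) ∧
      (∀ z ≤ 1, w ≤ |z - 1 / 3| → w ≤ |z - 2 / 3| → v'.cdf z = v.cdf z) ∧
      v'.cdf (1 / 3) = v.cdf (1 / 3) + a ∧ v'.cdf (2 / 3) = v.cdf (2 / 3) + b := by
  set d : ℝ → ℝ := fun x =>
    v.density x + (bump (1 / 3) w w' a x + bump (2 / 3) w w' b x) with hd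
  have hbump : Integrable fun x => bump (1 / 3) w w' a x + bump (2 / 3) w w' b x :=
    (integrable_bump _ _ _ _).add (integrable_bump _ _ _ _)
  have hint : ∀ z ≤ 1, ∫ x in Icc 0 z, d x = v.cdf z +
      (∫ x in Icc 0 z, bump (1 / 3) w w' a x) + ∫ x in Icc 0 z, bump (2 / 3) w w' b x := by
    intro z hz
    rw [integral_add (v.integrableOn (Icc_subset_Icc_right hz)) hbump.integrableOn,
      integral_add (integrable_bump _ _ _ _).integrableOn (integrable_bump _ _ _ _).integrableOn,
      add_assoc]
    rfl
  have hout : ∀ z ≤ 1, w ≤ |z - 1 / 3| → w ≤ |z - 2 / 3| → ∫ x in Icc 0 z, d x = v.cdf z := by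
    intro z hz h1 h2
    rw [hint z hz, setIntegral_bump_of_le_abs (by linarith) hw' hw h1,
      setIntegral_bump_of_le_abs (by linarith) hw' hw h2, add_zero, add_zero]
  have hone : ∀ x, |x - 1 / 3| ≤ w' ∨ |x - 2 / 3| ≤ w' → d x = 1 := by
    intro x hx
    rw [hd]
    dsimp only
    rw [hv' x (hx.imp (fun h => h.trans hw.le) fun h => h.trans hw.le)]
    rcases hx with h | h
    · rw [bump_eq_zero hw' hw (Or.inl h), bump_eq_zero hw' hw (Or.inr _)]
      · ring
      · have := abs_le.1 h
        rw [abs_sub_comm]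
        exact lt_of_lt_of_le (by linarith) (le_abs_self _)
    · rw [bump_eq_zero hw' hw (Or.inr _), bump_eq_zero hw' hw (Or.inl h)]
      · ring
      · have := abs_le.1 h
        exact lt_of_lt_of_le (by linarith) (le_abs_self _)
  -- The deviations do not accumulate: as `w < 1 / 6` the two windows are disjoint, and inside them
  -- `v` has density exactly `1`.
  have hκd : ∀ x ∈ Icc (0 : ℝ) 1, |d x - 1| ≤ κ := by
    intro x hx
    rw [hd]
    dsimp only
    by_cases h1 : |x - 1 / 3| ≤ w
    · rw [hv' x (Or.inl h1), bump_eq_zero (c := 2 / 3) hw' hw, add_zero, add_sub_cancel_left]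
      · exact abs_bump_le hw' hw ha x
      · have := abs_le.1 h1
        rw [abs_sub_comm]
        exact Or.inr (lt_of_lt_of_le (by linarith) (le_abs_self _))
    · rw [bump_eq_zero (c := 1 / 3) hw' hw (Or.inr (not_le.1 h1)), zero_add]
      by_cases h2 : |x - 2 / 3| ≤ w
      · rw [hv' x (Or.inr h2), add_sub_cancel_left]
        exact abs_bump_le hw' hw hb x
      · rw [bump_eq_zero hw' hw (Or.inr (not_le.1 h2)), add_zero]
        exact hv x hx
  refine ⟨⟨d, fun x hx => ?_, v.integrable.add hbump.integrableOn, ?_⟩, hκd, hone, hout, ?_, ?_⟩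
  · linarith [(abs_le.1 (hκd x hx)).1]
  · rw [hout 1 le_rfl, v.cdf_one]
    · rw [abs_of_nonneg] <;> linarith
    · rw [abs_of_nonneg] <;> linarith
  · refine (hint _ (by norm_num)).trans ?_
    rw [setIntegral_bump_center (by linarith) hw' hw,
      setIntegral_bump_of_le_abs (by linarith) hw' hw, add_zero]
    rw [abs_sub_comm, abs_of_nonneg] <;> linarith
  · refine (hint _ (by norm_num)).trans ?_
    rw [setIntegral_bump_center (by linarith) hw' hw,
      setIntegral_bump_of_le_abs (by linarith) hw' hw, add_zero]
    rw [abs_of_nonneg] <;> linarith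

/-! ### Moving both cuts creates envy -/

/-- The value of the three pieces demarcated by two points, in terms of the values `X` and `Y` of
the initial segments that end there. -/
def pieceValue (X Y : ℝ) : Fin 3 → ℝ := ![X, Y - X, 1 - Y]

/-- `X` moves in the direction of `x`, at a speed between `3/4` and `5/4`, and `x` moves by at
least `w`. -/
def Displaced (w x : ℝ) (X : Fin 3 → ℝ) : Prop :=
  (w ≤ x ∧ ∀ i, 3 / 4 * x ≤ X i ∧ X i ≤ 5 / 4 * x) ∨
    (x ≤ -w ∧ ∀ i, 5 / 4 * x ≤ X i ∧ X i ≤ 3 / 4 * x)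

set_option maxHeartbeats 1000000 in
/-- If every player `i` values the pieces `i` and `i+1` equally and above the third one, then
moving both cuts does not lead to an envy-free allocation. -/
theorem exists_envy {w ε x y : ℝ} {X Y X₀ Y₀ : Fin 3 → ℝ} (τ : Equiv.Perm (Fin 3))
    (hε : 0 < ε) (hw : 100 * ε ≤ w)
    (htie : ∀ i, pieceValue (X₀ i) (Y₀ i) i = pieceValue (X₀ i) (Y₀ i) (i + 1))
    (hval : ∀ i, |pieceValue (X₀ i) (Y₀ i) i - 7 / 20| ≤ 1 / 100)
    (hX : Displaced w x (X - X₀)) (hY : Displaced w y (Y - Y₀)) :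
    ∃ i j, pieceValue (X i) (Y i) (τ i) < pieceValue (X i) (Y i) (τ j) - ε := by
  by_contra! h
  have h' : ∀ i k, pieceValue (X i) (Y i) k - ε ≤ pieceValue (X i) (Y i) (τ i) := fun i k => by
    simpa using h i (τ.symm k)
  have h01 : τ 0 ≠ τ 1 := by simp
  have h12 : τ 1 ≠ τ 2 := by simp
  have h02 : τ 0 ≠ τ 2 := by simp
  obtain ⟨X, rfl⟩ : ∃ D, X = D + X₀ := ⟨X - X₀, by simp⟩
  obtain ⟨Y, rfl⟩ : ∃ D, Y = D + Y₀ := ⟨Y - Y₀, by simp⟩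
  simp only [add_sub_cancel_right] at hX hY
  have p0 : ∀ X Y, pieceValue X Y 0 = X := fun _ _ => rfl
  have p1 : ∀ X Y, pieceValue X Y 1 = Y - X := fun _ _ => rfl
  have p2 : ∀ X Y, pieceValue X Y 2 = 1 - Y := fun _ _ => rfl
  have A0 := h' 0 0
  have A1 := h' 0 1
  have A2 := h' 0 2
  have B0 := h' 1 0
  have B1 := h' 1 1
  have B2 := h' 1 2
  have C0 := h' 2 0
  have C1 := h' 2 1
  have C2 := h' 2 2
  have tA : _ = pieceValue _ _ 1 := htie 0
  have tB : _ = pieceValue _ _ 2 := htie 1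
  -- The cycle closes here: `2 + 1 = 0` in `Fin 3`.
  have tC : _ = pieceValue _ _ 0 := htie 2
  have vA := abs_le.1 (hval 0)
  have vB := abs_le.1 (hval 1)
  have vC := abs_le.1 (hval 2)
  clear h h' htie hval
  simp only [p0, p1, p2, Pi.add_apply] at A0 A1 A2 B0 B1 B2 C0 C1 C2 tA tB tC vA vB vC
  generalize τ 0 = a at *
  generalize τ 1 = b at *
  generalize τ 2 = c at *
  have key : ∀ a b c : Fin 3, a ≠ b → b ≠ c → a ≠ c →
      (a = 0 ∧ b = 1 ∧ c = 2) ∨ (a = 0 ∧ b = 2 ∧ c = 1) ∨ (a = 1 ∧ b = 0 ∧ c = 2) ∨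
      (a = 1 ∧ b = 2 ∧ c = 0) ∨ (a = 2 ∧ b = 0 ∧ c = 1) ∨ (a = 2 ∧ b = 1 ∧ c = 0) := by
    decide
  replace key := key a b c h01 h12 h02
  clear h01 h12 h02
  -- If the cuts approach each other, nobody wants piece 1; if they separate, players 0 and 1 both
  -- insist on it. If both move right, player 2 insists on piece 0, and piece 2 can only go to
  -- player 1, who takes it only if `X` moves about twice as far as `Y`. Then player 0 would also
  -- have to give up piece 0, requiring `Y` to move about twice as far as `X`; the speeds differ by
  -- a factor of at most `5/3` between players, and `(5/3)^2 < 4`. Moving left is symmetric.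
  rcases key with ⟨rfl, rfl, rfl⟩ | ⟨rfl, rfl, rfl⟩ | ⟨rfl, rfl, rfl⟩ | ⟨rfl, rfl, rfl⟩ |
    ⟨rfl, rfl, rfl⟩ | ⟨rfl, rfl, rfl⟩ <;>
  simp only [p0, p1, p2] at A0 A1 A2 B0 B1 B2 C0 C1 C2 <;>
  clear p0 p1 p2 <;>
  rcases hX with ⟨hx, hX⟩ | ⟨hx, hX⟩ <;> rcases hY with ⟨hy, hY⟩ | ⟨hy, hY⟩ <;>
  linarith [hX 0, hX 1, hX 2, hY 0, hY 1, hY 2]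

/-! ### Connected allocations as two cuts -/

/-- Disjoint intervals are ordered like any two of their points. -/
theorem lt_of_ordConnected_of_disjoint {A B : Set ℝ} (hA : A.OrdConnected) (hB : B.OrdConnected)
    (hAB : Disjoint A B) {a b p q : ℝ} (ha : a ∈ A) (hb : b ∈ B) (hab : a < b) (hp : p ∈ A)
    (hq : q ∈ B) : p < q := by
  by_contra! hqp
  rw [Set.disjoint_left] at hAB
  rcases le_total q b with h | h
  · rcases le_total q a with h' | h'
    · exact hAB ha (hB.out hq hb ⟨h', hab.le⟩)
    · exact hAB (hA.out ha hp ⟨h', hqp⟩) hq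
  · exact hAB (hA.out ha hp ⟨hab.le, h.trans hqp⟩) hb

/-- The pieces of a connected allocation can be listed from left to right. -/
theorem exists_perm_lt {n : ℕ} {A : Fin n → Set ℝ} (hA : ∀ i, (A i).OrdConnected)
    (hd : ∀ i j, i ≠ j → Disjoint (A i) (A j)) :
    ∃ σ : Equiv.Perm (Fin n), ∀ i j, i < j → ∀ p ∈ A (σ i), ∀ q ∈ A (σ j), p < q := by
  classical
  have : ∀ i, ∃ f : ℝ, (A i).Nonempty → f ∈ A i := fun i => by
    by_cases h : (A i).Nonempty
    · exact ⟨h.some, fun _ => h.some_mem⟩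
    -- An empty piece may be sorted anywhere, so the default `0` is harmless.
    · exact ⟨0, fun h' => absurd h' h⟩
  choose f hf using this
  refine ⟨Tuple.sort f, fun i j hij p hp q hq => ?_⟩
  have hne : Tuple.sort f i ≠ Tuple.sort f j := fun h => hij.ne ((Tuple.sort f).injective h)
  have hi := hf _ ⟨p, hp⟩
  have hj := hf _ ⟨q, hq⟩
  refine lt_of_ordConnected_of_disjoint (hA _) (hA _) (hd _ _ hne) hi hj ?_ hp hq
  refine lt_of_le_of_ne (Tuple.monotone_sort f hij.le) fun h => ?_
  exact Set.disjoint_left.1 (hd _ _ hne) hi (by rw [show f _ = f _ from h]; exact hj)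

/-- An initial segment of the cake is worth as much as `[0,x]`, where `x` is its right end. -/
theorem exists_value_eq_cdf {D : Set ℝ} (hD : D ⊆ Icc 0 1)
    (hlow : ∀ p ∈ D, ∀ q, 0 ≤ q → q < p → q ∈ D) :
    ∃ x ∈ Icc (0 : ℝ) 1, (x ∈ frontier D ∨ x = 0) ∧ (∀ z, 0 ≤ z → (∀ p ∈ D, p ≤ z) → x ≤ z) ∧
      (∀ p ∈ D, p ≤ x) ∧ ∀ v : Valuation, v.value D = v.cdf x := by
  rcases D.eq_empty_or_nonempty with rfl | hne
  · exact ⟨0, by simp, by simp, fun z hz _ => hz, by simp,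
      fun v => by rw [v.cdf_zero]; simp [Valuation.value]⟩
  have hbdd : BddAbove D := ⟨1, fun p hp => (hD hp).2⟩
  have hle : ∀ p ∈ D, p ≤ sSup D := fun p hp => le_csSup hbdd hp
  have hlub := isLUB_csSup hne hbdd
  obtain ⟨p₀, hp₀⟩ := hne
  refine ⟨sSup D, ⟨(hD hp₀).1.trans (hle p₀ hp₀), hlub.2 fun p hp => (hD hp).2⟩,
    Or.inl ⟨hlub.mem_closure ⟨p₀, hp₀⟩, ?_⟩, fun z _ hz => hlub.2 hz, hle, fun v => ?_⟩
  · intro hint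
    obtain ⟨r, hr, hball⟩ := Metric.mem_nhds_iff.1 (mem_interior_iff_mem_nhds.1 hint)
    have := hle (sSup D + r / 2) (hball (by simp [abs_of_pos hr, hr]))
    linarith
  · refine setIntegral_congr_set ?_
    have h1 : Ico 0 (sSup D) ⊆ D := fun q hq => by
      obtain ⟨p, hp, hqp⟩ := (lt_isLUB_iff hlub).1 hq.2
      exact hlow p hp q hq.1 hqp
    have h2 : D ⊆ Icc 0 (sSup D) := fun p hp => ⟨(hD hp).1, hle p hp⟩
    exact (LE.le.eventuallyLE h2).antisymm
      (Ico_ae_eq_Icc.symm.le.trans (LE.le.eventuallyLE h1))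

/-- A connected allocation to three players is given by two cuts and a matching of the players with
the pieces. -/
theorem IsConnectedAllocation.exists_cuts {A : Fin 3 → Set ℝ} (hA : IsConnectedAllocation A)
    {S : Set ℝ} (h0 : (0 : ℝ) ∈ S) (hS : DemarcatedBy S A) :
    ∃ x ∈ S, ∃ y ∈ S, 0 ≤ x ∧ x ≤ y ∧ y ≤ 1 ∧ ∃ τ : Equiv.Perm (Fin 3),
      ∀ (v : Valuation) i, v.value (A i) = pieceValue (v.cdf x) (v.cdf y) (τ i) := by
  obtain ⟨hc, hd, hU⟩ := hA
  obtain ⟨σ, hσ⟩ := exists_perm_lt hc hd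
  have hsub : ∀ i, A i ⊆ Icc 0 1 := fun i => hU ▸ subset_iUnion A i
  have hmem : ∀ q, 0 ≤ q → q ≤ 1 → q ∈ A (σ 0) ∨ q ∈ A (σ 1) ∨ q ∈ A (σ 2) := by
    intro q hq0 hq1
    have : q ∈ ⋃ i, A i := hU ▸ ⟨hq0, hq1⟩
    obtain ⟨i, hi⟩ := mem_iUnion.1 this
    obtain ⟨k, rfl⟩ := σ.surjective i
    fin_cases k
    exacts [Or.inl hi, Or.inr (Or.inl hi), Or.inr (Or.inr hi)]
  have h01 := hσ 0 1 (by decide)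
  have h02 := hσ 0 2 (by decide)
  have h12 := hσ 1 2 (by decide)
  obtain ⟨x, hx, hxf, hxle, -, hxv⟩ := exists_value_eq_cdf (hsub (σ 0)) fun p hp q hq hqp => by
    rcases hmem q hq (hqp.le.trans (hsub _ hp).2) with h | h | h
    · exact h
    · exact absurd (h01 p hp q h) hqp.not_gt
    · exact absurd (h02 p hp q h) hqp.not_gt
  obtain ⟨y, hy, hyf, -, hyle, hyv⟩ := exists_value_eq_cdf (D := A (σ 0) ∪ A (σ 1))
    (union_subset (hsub _) (hsub _)) fun p hp q hq hqp => by
      rcases hmem q hq (hqp.le.trans (union_subset (hsub _) (hsub _) hp).2) with h | h | h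
      · exact Or.inl h
      · exact Or.inr h
      · rcases hp with hp | hp
        · exact absurd (h02 p hp q h) hqp.not_gt
        · exact absurd (h12 p hp q h) hqp.not_gt
  have hmeas : ∀ i, MeasurableSet (A i) := fun i => (hc i).measurableSet
  have hne : ∀ i j : Fin 3, i ≠ j → Disjoint (A (σ i)) (A (σ j)) := fun i j hij =>
    hd _ _ fun h => hij (σ.injective h)
  refine ⟨x, ?_, y, ?_, hx.1, hxle y hy.1 fun p hp => hyle p (Or.inl hp), hy.2, σ.symm, ?_⟩
  · rcases hxf with h | rfl
    exacts [hS _ h, h0]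
  · rcases hyf with h | rfl
    · rcases frontier_union_subset _ _ h with h | h
      exacts [hS _ h.1, hS _ h.2]
    · exact h0
  intro v i
  obtain ⟨k, rfl⟩ := σ.surjective i
  rw [σ.symm_apply_apply]
  have e1 : v.value (A (σ 0) ∪ A (σ 1)) = v.value (A (σ 0)) + v.value (A (σ 1)) :=
    setIntegral_union (hne 0 1 (by decide)) (hmeas _) (v.integrableOn (hsub _))
      (v.integrableOn (hsub _))
  have e2 : v.value (Icc 0 1) = v.value (A (σ 0) ∪ A (σ 1)) + v.value (A (σ 2)) := by
    rw [← show A (σ 0) ∪ A (σ 1) ∪ A (σ 2) = Icc 0 1 from Subset.antisymm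
      (union_subset (union_subset (hsub _) (hsub _)) (hsub _))
      fun q hq => by simpa [or_assoc] using hmem q hq.1 hq.2]
    exact setIntegral_union (disjoint_union_left.2 ⟨hne 0 2 (by decide), hne 1 2 (by decide)⟩)
      (hmeas _) (v.integrableOn (union_subset (hsub _) (hsub _))) (v.integrableOn (hsub _))
  rw [hyv, hxv] at e1
  rw [hyv, show v.value (Icc 0 1) = 1 from v.total] at e2
  fin_cases k
  · exact hxv v
  · show v.value (A (σ 1)) = v.cdf y - v.cdf x
    linarith
  · show v.value (A (σ 2)) = 1 - v.cdf y
    linarith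

/-! ### Runs of a protocol -/

section Protocol

variable {n : ℕ} {R : CutRule} {P : Protocol n} {V V' : Fin n → Valuation}

theorem Reaches.zero_mem {h : List ℝ} {S : Set ℝ} (H : Reaches R P V h S) : (0 : ℝ) ∈ S := by
  induction H with
  | start => simp
  | cut _ _ ih => exact Or.inr ih
  | eval _ _ _ ih => exact ih

theorem Reaches.subset_Icc {h : List ℝ} {S : Set ℝ} (H : Reaches R P V h S) : S ⊆ Icc 0 1 := by
  induction H with
  | start => intro x hx; rcases hx with rfl | rfl <;> simp
  | cut _ _ ih => exact insert_subset (R.mem _ _) ih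
  | eval _ _ _ ih => exact ih

/-- Valuations that agree on all initial segments that end at available points cannot be told apart
by the protocol. -/
theorem Reaches.congr (hinj : ∀ i, InjOn (V' i).cdf (Icc 0 1)) {h : List ℝ} {S : Set ℝ}
    (H : Reaches R P V h S) (hV : ∀ i, ∀ s ∈ S, (V' i).cdf s = (V i).cdf s) :
    Reaches R P V' h S := by
  induction H with
  | start => exact .start
  | @cut h S i α _ hP ih =>
    -- The rule may treat `V' i` and `V i` differently, but injectivity leaves only one legal answer
    -- for `V' i`.
    have : R.point (V' i) α = R.point (V i) α := by
      refine hinj i (R.mem _ _) (R.mem _ _) ?_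
      rw [hV i _ (mem_insert _ _)]
      exact (R.value_eq _ _).trans (R.value_eq _ _).symm
    rw [← this]
    exact .cut (ih fun i s hs => hV i s (Or.inr hs)) hP
  | @eval h S i y _ hP hy ih =>
    have : (V' i).value (Icc 0 y) = (V i).value (Icc 0 y) := hV i y hy
    rw [← this]
    exact .eval (ih hV) hP hy

/-- Determinism: equal histories force the same action and hence the same answer. -/
theorem Reaches.unique {h h' : List ℝ} {S S' : Set ℝ} (H : Reaches R P V h S)
    (H' : Reaches R P V h' S') (hl : h.length = h'.length) : h = h' ∧ S = S' := by
  induction H generalizing h' S' with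
  | start =>
    cases H' with
    | start => exact ⟨rfl, rfl⟩
    | cut => simp at hl
    | eval => simp at hl
  | cut _ hP ih =>
    cases H' with
    | start => simp at hl
    | cut H' hP' =>
      obtain ⟨rfl, rfl⟩ := ih H' (by simpa using hl)
      cases hP.symm.trans hP'
      exact ⟨rfl, rfl⟩
    | eval H' hP' =>
      obtain ⟨rfl, rfl⟩ := ih H' (by simpa using hl)
      cases hP.symm.trans hP'
  | eval _ hP _ ih =>
    cases H' with
    | start => simp at hl
    | cut H' hP' =>
      obtain ⟨rfl, rfl⟩ := ih H' (by simpa using hl)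
      cases hP.symm.trans hP'
    | eval H' hP' =>
      obtain ⟨rfl, rfl⟩ := ih H' (by simpa using hl)
      cases hP.symm.trans hP'
      exact ⟨rfl, rfl⟩

/-- If a run passes through a moment with fewer answers than another one, then it continues from
there by a legal query. -/
theorem Reaches.query_of_length_lt {h h' : List ℝ} {S S' : Set ℝ} (H : Reaches R P V h S)
    (H' : Reaches R P V h' S') (hl : h.length < h'.length) :
    (∃ i α, P h = Action.cut i α) ∨ ∃ i, ∃ y ∈ S, P h = Action.eval i y := by
  induction H' with
  | start => simp at hl
  | cut H' hP ih =>
    rw [List.length_append, List.length_singleton, Nat.lt_succ_iff] at hl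
    rcases hl.lt_or_eq with hl | hl
    · exact ih hl
    · obtain ⟨rfl, rfl⟩ := H.unique H' hl
      exact Or.inl ⟨_, _, hP⟩
  | eval H' hP hy ih =>
    rw [List.length_append, List.length_singleton, Nat.lt_succ_iff] at hl
    rcases hl.lt_or_eq with hl | hl
    · exact ih hl
    · obtain ⟨rfl, rfl⟩ := H.unique H' hl
      exact Or.inr ⟨_, _, hy, hP⟩

/-- A run of a protocol that outputs an allocation `A` after `q` queries passes through every
moment that can be reached, either outputting `A` there or continuing by a legal query. -/
theorem Outputs.of_reaches {q : ℕ} {A : Fin n → Set ℝ} (hO : Outputs R P V q A) {h : List ℝ}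
    {S : Set ℝ} (H : Reaches R P V h S) :
    h.length ≤ q ∧ (DemarcatedBy S A ∨ (∃ i α, P h = Action.cut i α) ∨
      ∃ i, ∃ y ∈ S, P h = Action.eval i y) := by
  obtain ⟨h', S', H', rfl, hP, hD⟩ := hO
  rcases lt_trichotomy h.length h'.length with hl | hl | hl
  · exact ⟨hl.le, Or.inr (H.query_of_length_lt H' hl)⟩
  · obtain ⟨rfl, rfl⟩ := H.unique H' hl
    exact ⟨le_rfl, Or.inl hD⟩
  · rcases H'.query_of_length_lt H hl with ⟨i, α, h⟩ | ⟨i, y, _, h⟩ <;> cases hP.symm.trans h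

end Protocol

/-! ### Undecided players -/

/-- The direction in which the values of `[0,1/3]` and `[0,2/3]` can move while player `i` values
the pieces `i` and `i+1` equally. -/
def direction : Fin 3 → ℝ × ℝ := ![(1, 2), (-2, -1), (1, -1)]

/-- Player `i` values the pieces `i` and `i+1` demarcated by `1/3` and `2/3` equally and above the
third one, and has uniform density on intervals of radius `w` around `1/3` and `2/3`. -/
structure Undecided (w : ℝ) (i : Fin 3) (v : Valuation) : Prop where
  abs_density_sub_one_le : ∀ x ∈ Icc (0 : ℝ) 1, |v.density x - 1| ≤ 1 / 4
  density_eq_one : ∀ x, |x - 1 / 3| ≤ w ∨ |x - 2 / 3| ≤ w → v.density x = 1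
  tie : pieceValue (v.cdf (1 / 3)) (v.cdf (2 / 3)) i =
    pieceValue (v.cdf (1 / 3)) (v.cdf (2 / 3)) (i + 1)
  -- The summand `w` is a budget for later shifts: a shift by `2 * w / 17` and the new budget `w /
  -- 17` together stay below `w`.
  abs_value_sub_le : |pieceValue (v.cdf (1 / 3)) (v.cdf (2 / 3)) i - 7 / 20| + w ≤ 1 / 100

theorem Undecided.mono {w w' : ℝ} {i : Fin 3} {v : Valuation} (hv : Undecided w i v)
    (hw : w' ≤ w) : Undecided w' i v where
  abs_density_sub_one_le := hv.1
  density_eq_one x hx := hv.2 x (hx.imp (fun h => h.trans hw) fun h => h.trans hw)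
  tie := hv.3
  abs_value_sub_le := by linarith [hv.4]

theorem Undecided.le_density {w : ℝ} {i : Fin 3} {v : Valuation} (hv : Undecided w i v) :
    ∀ x ∈ Icc (0 : ℝ) 1, 3 / 4 ≤ v.density x := fun x hx => by
  linarith [(abs_le.1 (hv.1 x hx)).1]

theorem Undecided.density_le {w : ℝ} {i : Fin 3} {v : Valuation} (hv : Undecided w i v) :
    ∀ x ∈ Icc (0 : ℝ) 1, v.density x ≤ 5 / 4 := fun x hx => by
  linarith [(abs_le.1 (hv.1 x hx)).2]

theorem Undecided.injOn_cdf {w : ℝ} {i : Fin 3} {v : Valuation} (hv : Undecided w i v) :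
    InjOn v.cdf (Icc 0 1) :=
  (v.cdf_strictMonoOn (by norm_num) hv.le_density).injOn

theorem pieceValue_add_direction (i : Fin 3) (X Y u : ℝ) :
    pieceValue (X + u * (direction i).1) (Y + u * (direction i).2) i = pieceValue X Y i + u := by
  fin_cases i <;> simp [pieceValue, direction] <;> ring

theorem pieceValue_succ_add_direction (i : Fin 3) (X Y u : ℝ) :
    pieceValue (X + u * (direction i).1) (Y + u * (direction i).2) (i + 1) =
      pieceValue X Y (i + 1) + u := by
  fin_cases i <;> simp [pieceValue, direction] <;> ring

/-- The lower bound makes a shift move the cut point far enough; the upper bound limits the change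
of the density. -/
theorem abs_direction_fst (i : Fin 3) : 1 ≤ |(direction i).1| ∧ |(direction i).1| ≤ 2 := by
  fin_cases i <;> simp [direction]

theorem abs_direction_snd (i : Fin 3) : 1 ≤ |(direction i).2| ∧ |(direction i).2| ≤ 2 := by
  fin_cases i <;> simp [direction]

theorem abs_mul_le_quarter {w w' u d : ℝ} (hu : |u| ≤ (w - w') / 8) (hd : |d| ≤ 2) :
    |u * d| ≤ 1 / 4 * (w - w') := by
  rw [abs_mul]
  nlinarith [abs_nonneg u, abs_nonneg d]

/-- The values that the player gives to the tied pieces can be changed by a small amount. -/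
theorem exists_shift {w w' u : ℝ} {i : Fin 3} {v : Valuation} (hw' : 0 < w') (hw : w' < w)
    (hw6 : w < 1 / 6) (hu : |u| ≤ (w - w') / 8)
    (h1 : ∀ x ∈ Icc (0 : ℝ) 1, |v.density x - 1| ≤ 1 / 4)
    (h2 : ∀ x, |x - 1 / 3| ≤ w ∨ |x - 2 / 3| ≤ w → v.density x = 1)
    (h3 : pieceValue (v.cdf (1 / 3)) (v.cdf (2 / 3)) i =
      pieceValue (v.cdf (1 / 3)) (v.cdf (2 / 3)) (i + 1))
    (h4 : |pieceValue (v.cdf (1 / 3)) (v.cdf (2 / 3)) i + u - 7 / 20| + w' ≤ 1 / 100) :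
    ∃ v', Undecided w' i v' ∧
      (∀ z ≤ 1, w ≤ |z - 1 / 3| → w ≤ |z - 2 / 3| → v'.cdf z = v.cdf z) ∧
      v'.cdf (1 / 3) = v.cdf (1 / 3) + u * (direction i).1 ∧
      v'.cdf (2 / 3) = v.cdf (2 / 3) + u * (direction i).2 := by
  obtain ⟨v', k1, k2, k3, kX, kY⟩ := v.exists_perturb hw' hw hw6 (by norm_num)
    (abs_mul_le_quarter hu (abs_direction_fst i).2)
    (abs_mul_le_quarter hu (abs_direction_snd i).2) h1 h2
  refine ⟨v', ⟨k1, k2, ?_, ?_⟩, k3, kX, kY⟩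
  · rw [kX, kY, pieceValue_add_direction, pieceValue_succ_add_direction, h3]
  · rwa [kX, kY, pieceValue_add_direction]

/-- The uniform valuation. -/
noncomputable def Valuation.uniform : Valuation where
  density _ := 1
  nonneg _ _ := zero_le_one
  integrable := integrableOn_const (by simp)
  total := by simp

theorem Valuation.cdf_uniform {z : ℝ} (hz : 0 ≤ z) : Valuation.uniform.cdf z = z := by
  simp [Valuation.cdf, Valuation.value, Valuation.uniform, hz]

theorem exists_undecided (i : Fin 3) : ∃ v, Undecided (1 / 100) i v := by
  have h : ∀ k, pieceValue (Valuation.uniform.cdf (1 / 3)) (Valuation.uniform.cdf (2 / 3)) k =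
      1 / 3 := by
    intro k
    rw [Valuation.cdf_uniform (by norm_num), Valuation.cdf_uniform (by norm_num)]
    fin_cases k <;> norm_num [pieceValue]
  -- `1 / 60 = 7 / 20 - 1 / 3` lifts the tied pieces from `1 / 3` to the target; the width `4 / 25 <
  -- 1 / 6` is large enough for this shift.
  obtain ⟨v, hv, -⟩ := exists_shift (w := 4 / 25) (w' := 1 / 100) (u := 1 / 60) (i := i)
    (v := Valuation.uniform) (by norm_num) (by norm_num) (by norm_num)
    (by rw [abs_of_pos] <;> norm_num) (by simp [Valuation.uniform]) (by simp [Valuation.uniform])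
    (by rw [h, h]) (by rw [h]; norm_num)
  exact ⟨v, hv⟩

/-- A shift by one of `-2 * w`, `0` and `2 * w` keeps two numbers away from `0`. -/
theorem exists_shift_avoiding {w a b d e : ℝ} (hw : 0 < w) (hd : 1 ≤ |d|) (he : 1 ≤ |e|) :
    ∃ u, |u| ≤ 2 * w ∧ w ≤ |a - u * d| ∧ w ≤ |b - u * e| := by
  -- Pigeonhole: the three candidates are `2 * w` apart, so each of the two constraints excludes at
  -- most one.
  have aux : ∀ {a d u u' : ℝ}, 1 ≤ |d| → |a - u * d| < w → |a - u' * d| < w →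
      u + 2 * w ≤ u' → False := by
    intro a d u u' hd h h' huu
    have h2 : |(u' - u) * d| < 2 * w := by
      rw [show (u' - u) * d = (a - u * d) - (a - u' * d) by ring]
      linarith [abs_sub (a - u * d) (a - u' * d)]
    rw [abs_mul, abs_of_pos (by linarith)] at h2
    nlinarith
  by_contra! h
  have h1 : ∀ u, |u| ≤ 2 * w → |a - u * d| < w ∨ |b - u * e| < w := fun u hu => by
    by_contra! h2
    exact (h u hu h2.1).not_ge h2.2
  have hw2 : |2 * w| ≤ 2 * w := (abs_of_pos (by linarith)).le
  rcases h1 (-(2 * w)) (by rwa [abs_neg]) with h2 | h2 <;>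
  rcases h1 0 (by rw [abs_zero]; linarith) with h3 | h3 <;>
  rcases h1 (2 * w) hw2 with h4 | h4
  all_goals first
    | exact aux hd h2 h3 (by linarith)
    | exact aux hd h2 h4 (by linarith)
    | exact aux hd h3 h4 (by linarith)
    | exact aux he h2 h3 (by linarith)
    | exact aux he h2 h4 (by linarith)
    | exact aux he h3 h4 (by linarith)

/-- Players can answer a cut query away from `1/3` and `2/3`. -/
theorem Undecided.exists_answer (R : CutRule) {w : ℝ} {i : Fin 3} {v : Valuation}
    (hw : 0 < w) (hv : Undecided w i v) (α : Icc (0 : ℝ) 1) :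
    ∃ v', Undecided (w / 17) i v' ∧
      (∀ z ≤ 1, w ≤ |z - 1 / 3| → w ≤ |z - 2 / 3| → v'.cdf z = v.cdf z) ∧
      w / 17 ≤ |R.point v' α - 1 / 3| ∧ w / 17 ≤ |R.point v' α - 2 / 3| := by
  obtain ⟨u, hu, hX, hY⟩ := exists_shift_avoiding (w := w / 17) (a := α - v.cdf (1 / 3))
    (b := α - v.cdf (2 / 3)) (by linarith) (abs_direction_fst i).1 (abs_direction_snd i).1
  have hw1 : w ≤ 1 / 100 := by
    have := abs_nonneg (pieceValue (v.cdf (1 / 3)) (v.cdf (2 / 3)) i - 7 / 20)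
    linarith [hv.4]
  -- The factor `17` balances `|u| ≤ 2 * w'` against the allowed `(w - w') / 8` for `w' = w / 17`.
  obtain ⟨v', hv', hout, kX, kY⟩ := exists_shift (w := w) (w' := w / 17) (u := u) (i := i) (v := v)
    (by linarith) (by linarith) (by linarith) (by linarith) hv.1 hv.2 hv.3 (by
      have := abs_add_le (pieceValue (v.cdf (1 / 3)) (v.cdf (2 / 3)) i - 7 / 20) u
      rw [sub_add_eq_add_sub] at this
      linarith [hv.4])
  have hα : v'.cdf (R.point v' α) = α := R.value_eq v' α
  refine ⟨v', hv', hout, ?_, ?_⟩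
  -- An answer this close to `1/3` lies where the density is `1`, so its offset equals `α - v'.cdf
  -- (1 / 3)`, which `u` made too large.
  · by_contra! h
    have := v'.cdf_sub_eq_sub (by linarith) (by linarith)
      (fun x hx => hv'.2 x (Or.inl hx.le)) h
    rw [← this, hα, kX, ← sub_sub] at h
    linarith
  · by_contra! h
    have := v'.cdf_sub_eq_sub (by linarith) (by linarith)
      (fun x hx => hv'.2 x (Or.inr hx.le)) h
    rw [← this, hα, kY, ← sub_sub] at h
    linarith

theorem displaced_cdf {w z c : ℝ} {V : Fin 3 → Valuation} (hV : ∀ i, Undecided w i (V i))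
    (hz : z ∈ Icc (0 : ℝ) 1) (hc : c ∈ Icc (0 : ℝ) 1) (h : w ≤ |z - c|) :
    Displaced w (z - c) ((fun i => (V i).cdf z) - fun i => (V i).cdf c) := by
  rcases le_total c z with hcz | hcz
  · refine Or.inl ⟨by rwa [abs_of_nonneg (sub_nonneg.2 hcz)] at h, fun i => ⟨?_, ?_⟩⟩
    · exact (V i).le_cdf_sub (hV i).le_density hc.1 hcz hz.2
    · exact (V i).cdf_sub_le (hV i).density_le hc.1 hcz hz.2
  · refine Or.inr ⟨?_, fun i => ⟨?_, ?_⟩⟩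
    · rw [abs_of_nonpos (sub_nonpos.2 hcz)] at h
      linarith
    · have := (V i).cdf_sub_le (hV i).density_le hz.1 hcz hc.2
      simp only [Pi.sub_apply]
      linarith
    · have := (V i).le_cdf_sub (hV i).le_density hz.1 hcz hc.2
      simp only [Pi.sub_apply]
      linarith

/-- No connected allocation demarcated by points away from `1/3` and `2/3` is envy-free. -/
theorem not_isEnvyFree_of_undecided {w ε : ℝ} {V : Fin 3 → Valuation} {A : Fin 3 → Set ℝ}
    {S : Set ℝ} (hε : 0 < ε) (hw : 100 * ε ≤ w) (hV : ∀ i, Undecided w i (V i))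
    (hS : S ⊆ Icc 0 1) (h0 : (0 : ℝ) ∈ S) (hSw : ∀ s ∈ S, w ≤ |s - 1 / 3| ∧ w ≤ |s - 2 / 3|)
    (hA : IsConnectedAllocation A) (hD : DemarcatedBy S A) : ¬ IsEnvyFree ε V A := by
  intro hE
  obtain ⟨x, hx, y, hy, hx0, hxy, hy1, τ, hτ⟩ := hA.exists_cuts h0 hD
  obtain ⟨i, j, hij⟩ := exists_envy (w := w) (ε := ε) (x := x - 1 / 3) (y := y - 2 / 3)
    (X := fun i => (V i).cdf x) (Y := fun i => (V i).cdf y)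
    (X₀ := fun i => (V i).cdf (1 / 3)) (Y₀ := fun i => (V i).cdf (2 / 3))
    τ hε hw (fun i => (hV i).tie)
    (fun i => by linarith [(hV i).abs_value_sub_le])
    (displaced_cdf hV (hS hx) ⟨by norm_num, by norm_num⟩ (hSw x hx).1)
    (displaced_cdf hV (hS hy) ⟨by norm_num, by norm_num⟩ (hSw y hy).2)
  have := hE i j
  rw [hτ, hτ] at this
  exact this.not_gt hij

/-! ### The adversary and the count of queries -/

/-- As long as the players can stay undecided at a scale above `ε`, another query is needed. -/
theorem exists_reaches_of_length {R : CutRule} {ε : ℝ} {P : Protocol 3} (hε : 0 < ε)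
    (hP : FindsConnectedEnvyFree R ε P) (N : ℕ)
    (hN : ∀ k < N, 100 * ε ≤ 1 / 100 / 17 ^ k) :
    ∃ (V : Fin 3 → Valuation) (h : List ℝ) (S : Set ℝ), Reaches R P V h S ∧ h.length = N ∧
      (∀ i, Undecided (1 / 100 / 17 ^ N) i (V i)) ∧
      ∀ s ∈ S, 1 / 100 / 17 ^ N ≤ |s - 1 / 3| ∧ 1 / 100 / 17 ^ N ≤ |s - 2 / 3| := by
  induction N with
  | zero =>
    choose V hV using exists_undecided
    refine ⟨V, [], {0, 1}, .start, rfl, by simpa using hV, ?_⟩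
    rintro s (rfl | rfl) <;> norm_num [abs_of_pos, abs_of_neg]
  | succ N ih =>
    obtain ⟨V, h, S, H, hl, hV, hS⟩ := ih fun k hk => hN k (hk.trans (Nat.lt_succ_self _))
    have hw : (0 : ℝ) < 1 / 100 / 17 ^ N := by positivity
    have hNw := hN N (Nat.lt_succ_self _)
    rw [show (1 : ℝ) / 100 / 17 ^ (N + 1) = 1 / 100 / 17 ^ N / 17 by rw [pow_succ, div_mul_eq_div_div]]
    generalize (1 : ℝ) / 100 / 17 ^ N = w at *
    have hw' : w / 17 ≤ w := by linarith
    have hS' : ∀ s ∈ S, w / 17 ≤ |s - 1 / 3| ∧ w / 17 ≤ |s - 2 / 3| := fun s hs =>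
      ⟨hw'.trans (hS s hs).1, hw'.trans (hS s hs).2⟩
    obtain ⟨q, A, hO, hA, hE⟩ := hP V
    rcases (hO.of_reaches H).2 with hD | ⟨i, α, hq⟩ | ⟨i, y, hy, hq⟩
    · exact absurd hE
        (not_isEnvyFree_of_undecided hε hNw hV H.subset_Icc H.zero_mem hS hA hD)
    · obtain ⟨v', hv', hout, h1, h2⟩ := (hV i).exists_answer R hw α
      have hV' : ∀ k, Undecided (w / 17) k (Function.update V i v' k) := fun k => by
        rcases eq_or_ne k i with rfl | hk
        · rwa [Function.update_self]
        · rw [Function.update_of_ne hk]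
          exact (hV k).mono hw'
      -- All earlier points lie outside the windows, so the modified player would have given the
      -- same answers.
      have H' : Reaches R P (Function.update V i v') h S := by
        refine H.congr (fun k => (hV' k).injOn_cdf) fun k s hs => ?_
        rcases eq_or_ne k i with rfl | hk
        · rw [Function.update_self]
          exact hout s (H.subset_Icc hs).2 (hS s hs).1 (hS s hs).2
        · rw [Function.update_of_ne hk]
      refine ⟨_, _, _, .cut H' hq, by simp [hl], hV', ?_⟩
      rintro s (rfl | hs)
      · rw [Function.update_self]
        exact ⟨h1, h2⟩
      · exact hS' s hs
    · exact ⟨_, _, _, .eval H hq hy, by simp [hl], fun k => (hV k).mono hw', hS'⟩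

/-- About `log (1 / ε)` divisions by `17` lead from `1` to `ε`. -/
theorem le_div_pow_of_lt_log {ε : ℝ} (hε : 0 < ε) (hε' : ε < 1 / 10 ^ 8) {k : ℕ}
    (hk : (k : ℝ) < 1 / 6 * Real.log (1 / ε)) : 100 * ε ≤ 1 / 100 / 17 ^ k := by
  have h17 : Real.log 17 ≤ 3 := by
    rw [Real.log_le_iff_le_exp (by norm_num), show (3 : ℝ) = (3 : ℕ) * 1 by norm_num,
      Real.exp_nat_mul]
    refine le_trans ?_ (pow_le_pow_left₀ (by norm_num) Real.exp_one_gt_d9.le 3)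
    norm_num
  -- The constant `1 / 6` is `1 / (2 * 3)`: `3` bounds `log 17`, and `2` gains a square.
  have h1 : (17 : ℝ) ^ k * 17 ^ k ≤ 1 / ε := by
    rw [← Real.log_le_log_iff (by positivity) (by positivity), ← mul_pow, Real.log_pow,
      Real.log_mul (by norm_num) (by norm_num)]
    nlinarith [k.cast_nonneg (α := ℝ)]
  rw [le_div_iff₀ hε] at h1
  rw [le_div_iff₀ (by positivity)]
  -- The square is at most `ε`, which is below `1 / 10 ^ 8`.
  have h2 : (17 : ℝ) ^ k * ε ≤ 1 / 10 ^ 4 := by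
    refine le_of_sq_le_sq ?_ (by norm_num)
    nlinarith
  linarith

end CakeCutting

theorem mainTheorem1 :
    ∃ c : ℝ, 0 < c ∧ ∃ ε₀ : ℝ, 0 < ε₀ ∧
      ∀ (R : CakeCutting.CutRule) (ε : ℝ), 0 < ε → ε < ε₀ →
        ∀ P : CakeCutting.Protocol 3, CakeCutting.FindsConnectedEnvyFree R ε P →
          ∃ (V : Fin 3 → CakeCutting.Valuation) (q : ℕ) (A : Fin 3 → Set ℝ),
            CakeCutting.Outputs R P V q A ∧ c * Real.log (1 / ε) ≤ (q : ℝ) := by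
  refine ⟨1 / 6, by norm_num, 1 / 10 ^ 8, by norm_num, fun R ε hε hε' P hP => ?_⟩
  obtain ⟨V, h, S, H, hl, -⟩ := CakeCutting.exists_reaches_of_length hε hP
    ⌈1 / 6 * Real.log (1 / ε)⌉₊ fun _ hk =>
      CakeCutting.le_div_pow_of_lt_log hε hε' (Nat.lt_ceil.1 hk)
  obtain ⟨q, A, hO, -⟩ := hP V
  refine ⟨V, q, A, hO, (Nat.le_ceil _).trans ?_⟩
  rw [← hl]
  exact_mod_cast (hO.of_reaches H).1
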